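/- Let $X$ be a compact connected Riemann surface with canonical bundle $K$, and let $(V,Q,\Phi)$ be a $\mathrm{GL}(n,\mathbb{R})$-Higgs bundle on $X$: $V$ is a holomorphic vector bundle of rank $n$, $Q$ is a non-degenerate holomorphic symmetric form on $V$ with associated isomorphism $q\colon V\to V^*$, and $\Phi\in H^0(\mathrm{End}(V)\otimes K)$ is symmetric with respect to $Q$. Suppose that $(V,Q,\Phi)$ is a complex variation of Hodge structure: $V=F_{-m}\oplus F_{-m+1}\oplus\cdots\oplus F_m$ with $m\ge 0$ in $\tfrac12\mathbb{Z}$ and holomorphic bundles $F_k$, the bundles $F_k$ and $F_l$ are $Q$-orthogonal for $k+l\ne 0$ (so $q$ restricts to isomorphisms $F_k\cong F_{-k}^*$), and $\Phi$ restricts to maps $\Phi_k\colon F_k\to F_{k+1}\otimes K$ (with $F_{m+1}=0$). Suppose further that every $F_k$ is a line bundle and that $\Phi_k\colon F_k\to F_{k+1}\otimes K$ is an isomorphism for every $k<m$. (For genus at least $2$, $n\ge 3$ and $(V,Q,\Phi)$ stable, these are the non-zero $\Phi$ local minima of the $L^2$-norm of $\Phi$ on the moduli space; neither stability nor minimality is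 needed below.) Then $n=2m+1$, and the following hold. (1) If $n$ is even, then $F_{-1/2}^2\cong K$, and $F_{-1/2+k}\cong F_{-1/2}\otimes K^{-k}$ for all $k\in\mathbb{Z}$ with $-m\le -\tfrac12+k\le m$. (2) If $n$ is odd, then $F_0^2\cong\mathcal{O}$, and $F_k\cong F_0\otimes K^{-k}$ for all $k\in\mathbb{Z}$ with $-m\le k\le m$. (3) Put $L=F_{-1/2}$, $c=1$ if $n$ is even, and $L=F_0$, $c=0$ if $n$ is odd, and let $\sigma\colon L^2\to K^c$ be any isomorphism. Then $(V,Q,\Phi)$ is isomorphic, by an isomorphism which carries the summand $F_k$ to the summand $L_k$ for each $k$, to the $\mathrm{GL}(n,\mathbb{R})$-Higgs bundle on $L_{-m}\oplus\cdots\oplus L_m$, where $L_k=L\otimes K^{-k-c/2}$, given by $$q=\begin{pmatrix}0&\cdots&0&1\\ \vdots& &1&0\\ 0&\cdot^{\displaystyle\cdot^{\displaystyle\cdot}}& &\vdots\\ 1&0&\cdots&0\end{pmatrix},\qquad \Phi=\begin{pmatrix}0&\cdots&\cdots&0\\ 1&0& &\vdots\\ &\ddots&\ddots&\vdots\\ 0&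 &1&0\end{pmatrix}.$$ Here the entries $1$ of $q$ stand for the isomorphisms $L_k\cong L_{-k}^*$ given by the pairing $L_k\otimes L_{-k}=L^2\otimes K^{-c}\cong\mathcal{O}$ induced by $\sigma$, and the entries $1$ of $\Phi$ stand for the canonical identifications $L_k\cong L_{k+1}\otimes K$. -/

import Mathlib

open scoped Manifold ContDiff Bundle

noncomputable section

namespace GLHiggs

universe u v w

/-! ### Holomorphic vector bundles on a Riemann surface

A Riemann surface is a complex analytic manifold modelled on `ℂ`.  A holomorphic vector bundle is a
complex analytic vector bundle of finite rank over it, and a holomorphic bundle map is a fibrewise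
linear map which is complex analytic on total spaces. -/

/-- A holomorphic vector bundle (of finite rank) on `X`, bundled. -/
structure HolBundle (X : Type u) [TopologicalSpace X] [ChartedSpace ℂ X] where
  Model : Type v
  Fiber : X → Type v
  [normedAddCommGroup : NormedAddCommGroup Model]
  [normedSpace : NormedSpace ℂ Model]
  [finiteDimensional : FiniteDimensional ℂ Model]
  [topTotal : TopologicalSpace (Bundle.TotalSpace Model Fiber)]
  [addCommGroup : ∀ x, AddCommGroup (Fiber x)]
  [module : ∀ x, Module ℂ (Fiber x)]
  [topFiber : ∀ x, TopologicalSpace (Fiber x)]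
  [topAddGroup : ∀ x, IsTopologicalAddGroup (Fiber x)]
  [contSMul : ∀ x, ContinuousSMul ℂ (Fiber x)]
  [fiberBundle : FiberBundle Model Fiber]
  [vectorBundle : VectorBundle ℂ Model Fiber]
  [holomorphic : ContMDiffVectorBundle ω Model Fiber 𝓘(ℂ)]

attribute [instance] HolBundle.normedAddCommGroup HolBundle.normedSpace
  HolBundle.finiteDimensional HolBundle.topTotal HolBundle.addCommGroup HolBundle.module
  HolBundle.topFiber HolBundle.topAddGroup HolBundle.contSMul HolBundle.fiberBundle
  HolBundle.vectorBundle HolBundle.holomorphic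

section Bundles

variable {X : Type u} [TopologicalSpace X] [ChartedSpace ℂ X]

/-- The total space of a holomorphic vector bundle. -/
abbrev HolBundle.Total (E : HolBundle.{u, v} X) : Type (max u v) :=
  Bundle.TotalSpace E.Model E.Fiber

/-- The rank of a holomorphic vector bundle. -/
def HolBundle.rank (E : HolBundle.{u, v} X) : ℕ := Module.finrank ℂ E.Model

/-- A homomorphism of holomorphic vector bundles. -/
structure HolHom (E : HolBundle.{u, v} X) (F : HolBundle.{u, w} X) where
  toFun : ∀ x, E.Fiber x →L[ℂ] F.Fiber x
  holomorphic : ContMDiff (𝓘(ℂ).prod 𝓘(ℂ, E.Model)) (𝓘(ℂ).prod 𝓘(ℂ, F.Model)) ω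
    (fun p : E.Total => (⟨p.proj, toFun p.proj p.2⟩ : F.Total))

/-- An isomorphism of holomorphic vector bundles. -/
structure HolIso (E : HolBundle.{u, v} X) (F : HolBundle.{u, w} X) extends HolHom E F where
  inv : HolHom F E
  left_inv : ∀ x e, inv.toFun x (toFun x e) = e
  right_inv : ∀ x f, toFun x (inv.toFun x f) = f

/-- A homomorphism of holomorphic vector bundles is an isomorphism. -/
def HolHom.IsIso {E : HolBundle.{u, v} X} {F : HolBundle.{u, w} X} (f : HolHom E F) : Prop :=
  ∃ g : HolHom F E, (∀ x e, g.toFun x (f.toFun x e) = e) ∧ ∀ x e, f.toFun x (g.toFun x e) = e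

/-- The holomorphic vector bundle `Hom(E, F)`. -/
@[reducible]
def HolBundle.hom (E : HolBundle.{u, v} X) (F : HolBundle.{u, w} X) :
    HolBundle.{u, max v w} X where
  Model := E.Model →L[ℂ] F.Model
  Fiber := fun x => E.Fiber x →L[ℂ] F.Fiber x

variable (X) in
/-- The trivial line bundle `𝒪`. -/
@[reducible]
def trivialLine : HolBundle.{u, 0} X where
  Model := ℂ
  Fiber := Bundle.Trivial X ℂ

/-- The dual bundle `E^*`. -/
@[reducible]
def HolBundle.dual (E : HolBundle.{u, v} X) : HolBundle.{u, v} X where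
  Model := E.Model →L[ℂ] ℂ
  Fiber := fun x => E.Fiber x →L[ℂ] Bundle.Trivial X ℂ x

/-- The tensor product `E ⊗ F`, realised (the ranks being finite) as `Hom(E^*, F)`. -/
@[reducible]
def HolBundle.tensor (E : HolBundle.{u, v} X) (F : HolBundle.{u, w} X) :
    HolBundle.{u, max v w} X := E.dual.hom F

/-- The pure tensor `e ⊗ f`, i.e. the map `φ ↦ φ(e) f` on `E_x^*`. -/
def tmul {E : HolBundle.{u, v} X} {F : HolBundle.{u, w} X} {x : X}
    (e : E.Fiber x) (f : F.Fiber x) : (E.tensor F).Fiber x where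
  toFun φ := (show ℂ from φ e) • f
  map_add' φ ψ := add_smul (show ℂ from φ e) (show ℂ from ψ e) f
  map_smul' c φ := mul_smul c (show ℂ from φ e) f
  cont := by
    have h : Continuous fun φ : E.Fiber x →L[ℂ] ℂ => φ e := continuous_eval_const e
    exact h.smul continuous_const

/-- The map `f ⊗ 1 : E_x ⊗ G_x → F_x ⊗ G_x` induced by a linear map `f : E_x → F_x`. -/
def tensorMap (G : HolBundle.{u, w} X) {E F : HolBundle.{u, v} X} {x : X}
    (f : E.Fiber x →L[ℂ] F.Fiber x) (t : (E.tensor G).Fiber x) : (F.tensor G).Fiber x :=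
  t.comp (ContinuousLinearMap.precomp ℂ f)

/-- The homomorphisms `incl i : F i → V` exhibit `V` as the direct sum of the `F i`. -/
structure DirectSumDecomposition (V : HolBundle.{u, v} X) {N : ℕ}
    (F : Fin N → HolBundle.{u, v} X) where
  incl : ∀ i, HolHom (F i) V
  bijective : ∀ x, Function.Bijective
    (fun e : (∀ i, (F i).Fiber x) => ∑ i, (incl i).toFun x (e i))

end Bundles

/-! ### The canonical bundle and its powers -/

section Canonical

variable (X : Type u) [TopologicalSpace X] [ChartedSpace ℂ X] [IsManifold 𝓘(ℂ) ω X]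

/-- The transition function `dz_j / dz_i` of the holomorphic tangent bundle `TX = K^{-1}`. -/
def tangentTransition (i j : atlas ℂ X) (x : X) : ℂ :=
  (tangentBundleCore 𝓘(ℂ) X).coordChange i j x 1

variable {X} in
lemma tangentTransition_self (i : atlas ℂ X) (x : X) (hx : x ∈ i.1.source) :
    tangentTransition X i i x = 1 :=
  (tangentBundleCore 𝓘(ℂ) X).coordChange_self i x hx 1

variable {X} in
lemma tangentTransition_comp (i j k : atlas ℂ X) (x : X)
    (hx : x ∈ i.1.source ∩ j.1.source ∩ k.1.source) :
    tangentTransition X j k x * tangentTransition X i j x = tangentTransition X i k x := by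
  have h := (tangentBundleCore 𝓘(ℂ) X).coordChange_comp i j k x hx 1
  have h2 := ((tangentBundleCore 𝓘(ℂ) X).coordChange j k x).map_smul
    (tangentTransition X i j x) (1 : ℂ)
  rw [smul_eq_mul, mul_one] at h2
  unfold tangentTransition at *
  rw [← h, h2, smul_eq_mul, mul_comm]

variable {X} in
lemma tangentTransition_ne_zero (i j : atlas ℂ X) (x : X)
    (hx : x ∈ i.1.source ∩ j.1.source) : tangentTransition X i j x ≠ 0 := by
  intro h
  have h1 := tangentTransition_comp i j i x ⟨hx, hx.1⟩
  rw [h, mul_zero, tangentTransition_self i x hx.1] at h1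
  exact zero_ne_one h1

lemma contMDiffOn_tangentTransition (i j : atlas ℂ X) :
    ContMDiffOn 𝓘(ℂ) 𝓘(ℂ) ω (tangentTransition X i j) (i.1.source ∩ j.1.source) := by
  have : IsManifold 𝓘(ℂ) (ω + 1) X := inferInstanceAs (IsManifold 𝓘(ℂ) ω X)
  have : (tangentBundleCore 𝓘(ℂ) X).IsContMDiff 𝓘(ℂ) ω := tangentBundleCore.isContMDiff
  have h := (tangentBundleCore 𝓘(ℂ) X).contMDiffOn_coordChange (n := ω) 𝓘(ℂ) i j
  exact h.clm_apply contMDiffOn_const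

lemma contMDiffOn_tangentTransition_zpow (i j : atlas ℂ X) (d : ℤ) :
    ContMDiffOn 𝓘(ℂ) 𝓘(ℂ) ω (fun x => tangentTransition X i j x ^ d)
      (i.1.source ∩ j.1.source) := by
  intro x hx
  have h := contMDiffOn_tangentTransition X i j x hx
  have h0 := tangentTransition_ne_zero i j x hx
  have hz : ContDiffAt ℂ ω (fun z : ℂ => z ^ d) (tangentTransition X i j x) :=
    (analyticAt_id.zpow h0).contDiffAt
  exact hz.contMDiffAt.comp_contMDiffWithinAt x h

/-- The cocycle of the line bundle `K^d`, `d ∈ ℤ`: the transition functions are the powers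
`(dz_j / dz_i)^{-d}`, in terms of the frames `(dz_i)^d` attached to the charts `z_i`. -/
def canonicalCore (d : ℤ) : VectorBundleCore ℂ X ℂ (atlas ℂ X) where
  baseSet i := i.1.source
  isOpen_baseSet i := i.1.open_source
  indexAt := achart ℂ
  mem_baseSet_at := mem_chart_source ℂ
  coordChange i j x := (tangentTransition X i j x ^ (-d)) • ContinuousLinearMap.id ℂ ℂ
  coordChange_self i x hx v := by simp [tangentTransition_self i x hx]
  continuousOn_coordChange i j :=
    (contMDiffOn_tangentTransition_zpow X i j (-d)).continuousOn.smul continuousOn_const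
  coordChange_comp i j k x hx v := by
    simp [← tangentTransition_comp i j k x hx, mul_zpow]
    ring

instance canonicalCore_isContMDiff (d : ℤ) : (canonicalCore X d).IsContMDiff 𝓘(ℂ) ω where
  contMDiffOn_coordChange i j :=
    (contMDiffOn_tangentTransition_zpow X i j (-d)).smul contMDiffOn_const

instance canonicalCore_topAddGroup (d : ℤ) (x : X) :
    IsTopologicalAddGroup ((canonicalCore X d).Fiber x) := inferInstanceAs (IsTopologicalAddGroup ℂ)

instance canonicalCore_contSMul (d : ℤ) (x : X) :
    ContinuousSMul ℂ ((canonicalCore X d).Fiber x) := inferInstanceAs (ContinuousSMul ℂ ℂ)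

/-- The holomorphic line bundle `K^d`, `d ∈ ℤ`.  Its fibre at `x` is `ℂ`, a number `s` standing for
`s (dz)^d` where `z` is the preferred chart at `x`. -/
@[reducible]
def canonicalPow (d : ℤ) : HolBundle.{u, 0} X where
  Model := ℂ
  Fiber := (canonicalCore X d).Fiber

/-- The canonical bundle `K` (the holomorphic cotangent bundle). -/
abbrev canonical : HolBundle.{u, 0} X := canonicalPow X 1

variable {X}

/-- The product `K_x^a × K_x^b → K_x^c`, `c = a + b`. -/
def kmul {a b c : ℤ} (_h : a + b = c) {x : X} (s : (canonicalPow X a).Fiber x)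
    (t : (canonicalPow X b).Fiber x) : (canonicalPow X c).Fiber x :=
  (show ℂ from s) * (show ℂ from t)

/-- The identification `𝒪_x = K_x^0`. -/
def kunit {x : X} (s : (trivialLine X).Fiber x) : (canonicalPow X 0).Fiber x := s

/-- The identification `K_x^0 = ℂ`. -/
def kscalar {x : X} (s : (canonicalPow X 0).Fiber x) : ℂ := s

/-! ### `GL(n, ℝ)`-Higgs bundles -/

variable (X) in
/-- A `GL(n, ℝ)`-Higgs bundle `(V, Q, Φ)`: a holomorphic vector bundle `V` of rank `n`, a
non-degenerate holomorphic symmetric form `Q`, given by `q : V → V^*`, and a holomorphic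
`Φ : V → V ⊗ K` symmetric with respect to `Q`. -/
structure HiggsBundle (n : ℕ) where
  V : HolBundle.{u, v} X
  rank_eq : V.rank = n
  q : HolHom V V.dual
  q_symm : ∀ x u v, q.toFun x u v = q.toFun x v u
  q_nondegenerate : ∀ x u, (∀ v, q.toFun x u v = 0) → u = 0
  Φ : HolHom V (V.tensor (canonical X))
  /-- `Q(Φ u, v) = Q(u, Φ v)` in `K_x`; here `Q(e ⊗ κ, v) = Q(e, v) κ` is the value of
  the tensor `e ⊗ κ` on the form `q(v) ∈ V_x^*`. -/
  Φ_symm : ∀ x u v, Φ.toFun x u (q.toFun x v) = Φ.toFun x v (q.toFun x u)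

/-- An isomorphism of `GL(n, ℝ)`-Higgs bundles. -/
structure HiggsIso {n : ℕ} (H H' : HiggsBundle.{u, v} X n) extends HolIso H.V H'.V where
  map_q : ∀ x u v, H'.q.toFun x (toFun x u) (toFun x v) = H.q.toFun x u v
  map_Φ : ∀ x u, H'.Φ.toFun x (toFun x u) = tensorMap (canonical X) (toFun x) (H.Φ.toFun x u)

/-- The structure of a complex variation of Hodge structure on `(V, Q, Φ)`, with `r = 2m`: a direct
sum decomposition `V = F_{-m} ⊕ ⋯ ⊕ F_m`, the summand of index `i = 0, …, r` being `F_{i-m}`, such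
that `F_k` and `F_l` are orthogonal under `Q` for `k + l ≠ 0` (so that `q` restricts to isomorphisms
`F_k ≅ F_{-k}^*`) and `Φ` restricts to maps `Φ_k : F_k → F_{k+1} ⊗ K` (with `F_{m+1} = 0`). -/
structure HodgeStructure {n : ℕ} (H : HiggsBundle.{u, v} X n) where
  r : ℕ
  F : Fin (r + 1) → HolBundle.{u, v} X
  decomp : DirectSumDecomposition H.V F
  orthogonal : ∀ i j : Fin (r + 1), (i : ℕ) + j ≠ r → ∀ x e f,
    H.q.toFun x ((decomp.incl i).toFun x e) ((decomp.incl j).toFun x f) = 0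
  φ : ∀ i : Fin r, HolHom (F i.castSucc) ((F i.succ).tensor (canonical X))
  Φ_incl : ∀ (i : Fin r) x e, H.Φ.toFun x ((decomp.incl i.castSucc).toFun x e) =
    tensorMap (canonical X) ((decomp.incl i.succ).toFun x) ((φ i).toFun x e)
  Φ_last : ∀ x e, H.Φ.toFun x ((decomp.incl (Fin.last r)).toFun x e) = 0

/-- The weight `k ∈ {-m, …, m}` of the summand of index `i`. -/
def HodgeStructure.weight {n : ℕ} {H : HiggsBundle.{u, v} X n} (D : HodgeStructure H)
    (i : Fin (D.r + 1)) : ℚ := (i : ℚ) - (D.r : ℚ) / 2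

/-- All `F_k` are line bundles and all `Φ_k : F_k → F_{k+1} ⊗ K`, `k < m`, are isomorphisms. -/
structure HodgeStructure.IsChain {n : ℕ} {H : HiggsBundle.{u, v} X n}
    (D : HodgeStructure H) : Prop where
  rank_one : ∀ i, (D.F i).rank = 1
  isIso : ∀ i, (D.φ i).IsIso

/-- Standard form of a `GL(n, ℝ)`-Higgs bundle, for a line bundle `L` with a pairing
`β : L_x × L_x → K_x^c`, `n = 2b + 1 + c` (`c = 1`, `L^2 ≅ K` for `n` even; `c = 0`, `L^2 ≅ 𝒪` for
`n` odd).  It is a decomposition `V = ⊕_{i < n} L ⊗ K^{b-i}` in which: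
* `q` is the antidiagonal matrix with entries `1`, where `1` in position `i + j = n - 1` is the
  pairing of `L ⊗ K^{b-i}` with `L ⊗ K^{b-j}` given by `β` and
  `K^c ⊗ K^{b-i} ⊗ K^{b-j} = K^0 = 𝒪`;
* `Φ` is the matrix with entries `1` on the subdiagonal, where `1` in column `i` is the canonical
  identification `L ⊗ K^{b-i} = (L ⊗ K^{b-(i+1)}) ⊗ K`. -/
structure StandardForm {n : ℕ} (H : HiggsBundle.{u, v} X n) (L : HolBundle.{u, v} X) (b c : ℤ)
    (β : ∀ x, L.Fiber x → L.Fiber x → (canonicalPow X c).Fiber x) where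
  size : 2 * b + 1 + c = n
  decomp : DirectSumDecomposition H.V
    (fun i : Fin n => L.tensor (canonicalPow X (b - (i : ℕ))))
  q_antidiag : ∀ (i j : Fin n) (hij : (i : ℕ) + j + 1 = n) (x : X) (l l' : L.Fiber x)
    (s : (canonicalPow X (b - (i : ℕ))).Fiber x) (s' : (canonicalPow X (b - (j : ℕ))).Fiber x),
    H.q.toFun x ((decomp.incl i).toFun x (tmul l s)) ((decomp.incl j).toFun x (tmul l' s')) =
      kscalar (kmul (add_neg_cancel c) (β x l l') (kmul (by omega) s s'))
  q_zero : ∀ (i j : Fin n), (i : ℕ) + j + 1 ≠ n → ∀ x e f,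
    H.q.toFun x ((decomp.incl i).toFun x e) ((decomp.incl j).toFun x f) = 0
  Φ_subdiag : ∀ (i j : Fin n) (hij : (j : ℕ) = i + 1) (x : X) (l : L.Fiber x)
    (s : (canonicalPow X (b - (j : ℕ))).Fiber x) (κ : (canonical X).Fiber x),
    H.Φ.toFun x ((decomp.incl i).toFun x (tmul l (kmul (by omega) s κ))) =
      tmul ((decomp.incl j).toFun x (tmul l s)) κ
  Φ_last : ∀ i : Fin n, (i : ℕ) + 1 = n → ∀ x e,
    H.Φ.toFun x ((decomp.incl i).toFun x e) = 0

/-- `(V, Q, Φ) = ⊕ F_k` is isomorphic to a `GL(n, ℝ)`-Higgs bundle in standard form, by an isomorphism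
which takes each summand `F_{i-m}` to the summand of index `i` of the standard form. -/
def HodgeStructure.IsoStandard {n : ℕ} {H : HiggsBundle.{u, v} X n} (D : HodgeStructure H)
    (L : HolBundle.{u, v} X) (b c : ℤ)
    (β : ∀ x, L.Fiber x → L.Fiber x → (canonicalPow X c).Fiber x) : Prop :=
  ∃ (H' : HiggsBundle.{u, v} X n) (f : HiggsIso H H') (S : StandardForm H' L b c β),
    ∀ (i : Fin (D.r + 1)) (j : Fin n), (i : ℕ) = j → ∀ x,
      Set.range (fun e => f.toFun x ((D.decomp.incl i).toFun x e)) =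
        Set.range ((S.decomp.incl j).toFun x)

end Canonical

end GLHiggs

end

/-! Index the summands by `0, …, r`. At each point `x` pick a non-zero `v_0` in the first summand
and let `Φ` generate the rest: `Φ v_i = v_{i+1} ⊗ dz`, with `z` the preferred chart at `x`. In these
bases `Φ` has entries `1` by construction. Symmetry of `Φ` gives `Q(v_{i+1}, v_j) = Q(v_i,
v_{j+1})`, so all antidiagonal entries of `Q` equal one number `pairing x`, non-zero by
nondegeneracy (`q_eq_pairing`, `pairing_ne_zero`).

The `v_i` need not vary continuously with `x`, as neither the choice nor the preferred chart does.
The defect is controlled: with `R = dz / dz₀` there is a common factor `c` such that every `c R^i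
v_i` is holomorphic near `x₀` (`exists_factor`), and then `c² R^r pairing` is holomorphic too. A map
given on such bases is holomorphic once the factors agree (`HolIso.ofFiberBasis`). Counting powers
of `R` yields `F_a ⊗ K^{a-i} ≅ F_i` (`isoSummand`) and `F_a² ≅ K^{r-2a}` (`isoSquare`); the middle
index `a` makes the last exponent `1` or `0`.

An arbitrary `σ : F_a² ≅ K^c` differs from the one induced by `Q` by a nowhere zero holomorphic
function, constant because `X` is compact and connected. Writing the constant as `b²` and scaling
all summands by `b` turns the form induced by `Q` into the one given by `σ`, and leaves `Φ`
unchanged (`exists_eq_sq_smul_pairing`, `standardForm`). -/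

open scoped Topology

noncomputable section

namespace GLHiggs

universe u v w

open Filter

/-! ### Holomorphic sections, and maps of line bundles defined by bases of the fibres -/

section Sections

universe v'

variable {X : Type u} [TopologicalSpace X] [ChartedSpace ℂ X]

/-- The section `s` of `E` is holomorphic at `x₀`. -/
def HolAt (E : HolBundle.{u, v} X) (s : ∀ x, E.Fiber x) (x₀ : X) : Prop :=
  ContMDiffAt 𝓘(ℂ) (𝓘(ℂ).prod 𝓘(ℂ, E.Model)) ω (fun x => (⟨x, s x⟩ : E.Total)) x₀

variable {E : HolBundle.{u, v} X} {F : HolBundle.{u, w} X} {x₀ : X}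

/-- The linear identification of a fibre with the model given by the preferred trivialization. -/
def HolBundle.fiberEquiv (E : HolBundle.{u, v} X) (x : X) : E.Fiber x ≃L[ℂ] E.Model :=
  (trivializationAt E.Model E.Fiber x).continuousLinearEquivAt ℂ x
    (FiberBundle.mem_baseSet_trivializationAt' x)

/-- Carried over from the model, so that every linear map out of a fibre is continuous. -/
instance (E : HolBundle.{u, v} X) (x : X) : T2Space (E.Fiber x) :=
  (E.fiberEquiv x).toHomeomorph.symm.t2Space

instance (E : HolBundle.{u, v} X) (x : X) : FiniteDimensional ℂ (E.Fiber x) :=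
  (E.fiberEquiv x).symm.toLinearEquiv.finiteDimensional

lemma HolBundle.finrank_fiber (E : HolBundle.{u, v} X) (x : X) :
    Module.finrank ℂ (E.Fiber x) = E.rank :=
  (E.fiberEquiv x).toLinearEquiv.finrank_eq

lemma HolBundle.rank_hom (E : HolBundle.{u, v} X) (F : HolBundle.{u, w} X) :
    (E.hom F).rank = E.rank * F.rank := by
  change Module.finrank ℂ (E.Model →L[ℂ] F.Model) = _
  rw [← (LinearMap.toContinuousLinearMap (𝕜 := ℂ) (E := E.Model) (F' := F.Model)).finrank_eq,
    Module.finrank_linearMap]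
  rfl

lemma HolBundle.rank_dual (E : HolBundle.{u, v} X) : E.dual.rank = E.rank := by
  change (E.hom (trivialLine X)).rank = _
  rw [HolBundle.rank_hom, show (trivialLine X).rank = 1 from Module.finrank_self ℂ, mul_one]

lemma HolBundle.rank_tensor (E : HolBundle.{u, v} X) (F : HolBundle.{u, w} X) :
    (E.tensor F).rank = E.rank * F.rank := by
  rw [HolBundle.rank_hom, HolBundle.rank_dual]

lemma HolAt.congr {s t : ∀ x, E.Fiber x} (hs : HolAt E s x₀) (h : ∀ᶠ x in 𝓝 x₀, t x = s x) :
    HolAt E t x₀ :=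
  ContMDiffAt.congr_of_eventuallyEq hs (h.mono fun x hx => by simp only [hx])

lemma HolAt.smul {s : ∀ x, E.Fiber x} {c : X → ℂ} (hc : ContMDiffAt 𝓘(ℂ) 𝓘(ℂ) ω c x₀)
    (hs : HolAt E s x₀) : HolAt E (fun x => c x • s x) x₀ :=
  ContMDiffAt.smul_section hc hs

lemma HolHom.toFun_smul (f : HolHom E F) {x : X} (a : ℂ) (e : E.Fiber x) :
    f.toFun x (a • e) = a • f.toFun x e :=
  (f.toFun x).map_smul a e

lemma HolHom.toFun_zero (f : HolHom E F) (x : X) : f.toFun x 0 = 0 :=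
  (f.toFun x).map_zero

lemma HolHom.holAt (f : HolHom E F) {s : ∀ x, E.Fiber x} (hs : HolAt E s x₀) :
    HolAt F (fun x => f.toFun x (s x)) x₀ :=
  ContMDiffAt.comp x₀ (f.holomorphic _) hs

lemma HolAt.apply {T : ∀ x, (E.hom F).Fiber x} {s : ∀ x, E.Fiber x}
    (hT : HolAt (E.hom F) T x₀) (hs : HolAt E s x₀) : HolAt F (fun x => T x (s x)) x₀ :=
  ContMDiffAt.clm_bundle_apply (b := id) hT hs

lemma eventually_mem_baseSet (E : HolBundle.{u, v} X) (x₀ : X) :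
    ∀ᶠ x in 𝓝 x₀, x ∈ (trivializationAt E.Model E.Fiber x₀).baseSet :=
  (trivializationAt E.Model E.Fiber x₀).open_baseSet.mem_nhds
    (FiberBundle.mem_baseSet_trivializationAt' x₀)

lemma holAt_iff {s : ∀ x, E.Fiber x} : HolAt E s x₀ ↔ ContMDiffAt 𝓘(ℂ) 𝓘(ℂ, E.Model) ω
    (fun x => (trivializationAt E.Model E.Fiber x₀ ⟨x, s x⟩).2) x₀ :=
  Bundle.contMDiffAt_section x₀

lemma holAt_trivialLine_iff {c : X → ℂ} :
    HolAt (trivialLine X) c x₀ ↔ ContMDiffAt 𝓘(ℂ) 𝓘(ℂ) ω c x₀ := by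
  rw [holAt_iff]; rfl

/-- The section with constant coordinate `m` in the preferred trivialization at `x₀`. -/
def constSection (E : HolBundle.{u, v} X) (x₀ : X) (m : E.Model) (x : X) : E.Fiber x :=
  (trivializationAt E.Model E.Fiber x₀).symm x m

lemma holAt_constSection (E : HolBundle.{u, v} X) (x₀ : X) (m : E.Model) :
    HolAt E (constSection E x₀ m) x₀ := by
  rw [holAt_iff]
  refine (contMDiffAt_const (c := m)).congr_of_eventuallyEq ?_
  filter_upwards [eventually_mem_baseSet E x₀] with x hx
  simp [constSection, Bundle.Trivialization.apply_mk_symm _ hx]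

/-- Testing on the sections that are constant in the trivialization at `x₀` shows that the columns
of the matrix of `T` are holomorphic, and `T` is a fixed linear expression in its columns. -/
lemma holAt_hom_of_forall {T : ∀ x, (E.hom F).Fiber x}
    (h : ∀ s : ∀ x, E.Fiber x, HolAt E s x₀ → HolAt F (fun x => T x (s x)) x₀) :
    HolAt (E.hom F) T x₀ := by
  refine contMDiffAt_hom_bundle _ |>.2 ⟨contMDiffAt_id, ?_⟩
  dsimp only
  let b := Module.finBasis ℂ E.Model
  have key : ∀ A : E.Model →L[ℂ] F.Model,
      A = ∑ i, ContinuousLinearMap.smulRightL ℂ E.Model F.Model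
        (LinearMap.toContinuousLinearMap (b.coord i)) (A (b i)) := by
    intro A
    ext m
    conv_lhs => rw [← b.sum_repr m, map_sum]
    simp
  have h2 : ∀ m : E.Model, ContMDiffAt 𝓘(ℂ) 𝓘(ℂ, F.Model) ω (fun x =>
      ContinuousLinearMap.inCoordinates E.Model E.Fiber F.Model F.Fiber x₀ x x₀ x (T x) m) x₀ := by
    intro m
    refine (holAt_iff.1 (h _ (holAt_constSection E x₀ m))).congr_of_eventuallyEq ?_
    filter_upwards [eventually_mem_baseSet E x₀, eventually_mem_baseSet F x₀] with x hx hx'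
    rw [ContinuousLinearMap.inCoordinates_eq hx hx']
    simp [constSection, Bundle.Trivialization.continuousLinearEquivAt_apply]
  rw [funext fun x => key (ContinuousLinearMap.inCoordinates E.Model E.Fiber F.Model F.Fiber
    x₀ x x₀ x (T x))]
  refine contMDiffAt_finsetSum fun i _ => ?_
  exact (ContinuousLinearMap.contMDiff _).contMDiffAt.comp x₀ (h2 (b i))

lemma HolAt.tmul {e : ∀ x, E.Fiber x} {f : ∀ x, F.Fiber x} (he : HolAt E e x₀)
    (hf : HolAt F f x₀) : HolAt (E.tensor F) (fun x => GLHiggs.tmul (e x) (f x)) x₀ :=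
  holAt_hom_of_forall fun _ hs =>
    HolAt.smul (holAt_trivialLine_iff.1 (HolAt.apply (F := trivialLine X) hs he)) hf

/-- A linear coordinate on the model of a line bundle. -/
def modelCoord (hE : E.rank = 1) : E.Model ≃L[ℂ] ℂ :=
  ContinuousLinearEquiv.ofFinrankEq (hE.trans (Module.finrank_self ℂ).symm)

/-- The linear coordinate of `e` in the preferred trivialization at `x₀`. -/
def lineCoord (hE : E.rank = 1) (x₀ : X) (p : E.Total) : ℂ :=
  modelCoord hE (trivializationAt E.Model E.Fiber x₀ p).2

lemma HolAt.lineCoord (hE : E.rank = 1) {s : ∀ x, E.Fiber x} (hs : HolAt E s x₀) :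
    ContMDiffAt 𝓘(ℂ) 𝓘(ℂ) ω (fun x => lineCoord hE x₀ ⟨x, s x⟩) x₀ :=
  (modelCoord hE).toContinuousLinearMap.contMDiff.contMDiffAt.comp x₀ (holAt_iff.1 hs)

lemma lineCoord_smul (hE : E.rank = 1) {x : X}
    (hx : x ∈ (trivializationAt E.Model E.Fiber x₀).baseSet) (c : ℂ) (e : E.Fiber x) :
    lineCoord hE x₀ ⟨x, c • e⟩ = c * lineCoord hE x₀ ⟨x, e⟩ := by
  simp only [lineCoord]
  rw [((trivializationAt E.Model E.Fiber x₀).linear ℂ hx).map_smul, map_smul, smul_eq_mul]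

lemma lineCoord_inj (hE : E.rank = 1) {x : X}
    (hx : x ∈ (trivializationAt E.Model E.Fiber x₀).baseSet) {e f : E.Fiber x}
    (h : lineCoord hE x₀ ⟨x, e⟩ = lineCoord hE x₀ ⟨x, f⟩) : e = f := by
  have h1 := (modelCoord hE).injective h
  have h2 := ((trivializationAt E.Model E.Fiber x₀).continuousLinearEquivAt ℂ x hx).injective
    (a₁ := e) (a₂ := f)
  exact h2 h1

lemma lineCoord_ne_zero (hE : E.rank = 1) {x : X}
    (hx : x ∈ (trivializationAt E.Model E.Fiber x₀).baseSet) {e : E.Fiber x} (he : e ≠ 0) :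
    lineCoord hE x₀ ⟨x, e⟩ ≠ 0 := by
  intro h
  apply he
  apply lineCoord_inj hE hx
  rw [h, ← zero_smul ℂ e, lineCoord_smul hE hx, zero_mul]

/-- A holomorphic section of a line bundle is a holomorphic multiple of a local frame. -/
lemma exists_eventually_eq_smul (hE : E.rank = 1) {l s : ∀ x, E.Fiber x} (hl : HolAt E l x₀)
    (hl0 : ∀ᶠ x in 𝓝 x₀, l x ≠ 0) (hs : HolAt E s x₀) :
    ∃ c : X → ℂ, ContMDiffAt 𝓘(ℂ) 𝓘(ℂ) ω c x₀ ∧ ∀ᶠ x in 𝓝 x₀, s x = c x • l x := by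
  refine ⟨fun x => lineCoord hE x₀ ⟨x, s x⟩ / lineCoord hE x₀ ⟨x, l x⟩,
    (hs.lineCoord hE).div₀ (hl.lineCoord hE) (lineCoord_ne_zero hE
      (FiberBundle.mem_baseSet_trivializationAt' x₀) hl0.self_of_nhds), ?_⟩
  filter_upwards [eventually_mem_baseSet E x₀, hl0] with x hx hx0
  apply lineCoord_inj hE hx
  rw [lineCoord_smul hE hx, div_mul_cancel₀ _ (lineCoord_ne_zero hE hx hx0)]

lemma exists_local_frame (hE : E.rank = 1) (x₀ : X) :
    ∃ l : ∀ x, E.Fiber x, HolAt E l x₀ ∧ ∀ᶠ x in 𝓝 x₀, l x ≠ 0 := by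
  refine ⟨constSection E x₀ ((modelCoord hE).symm 1), holAt_constSection _ _ _, ?_⟩
  filter_upwards [eventually_mem_baseSet E x₀] with x hx h0
  have h1 : lineCoord hE x₀ ⟨x, constSection E x₀ ((modelCoord hE).symm 1) x⟩ = 1 := by
    simp [lineCoord, constSection, Bundle.Trivialization.apply_mk_symm _ hx]
  rw [h0, ← zero_smul ℂ (0 : E.Fiber x), lineCoord_smul hE hx, zero_mul] at h1
  exact zero_ne_one h1

lemma HolBundle.exists_eq_smul (hE : E.rank = 1) {x : X} {u : E.Fiber x} (hu : u ≠ 0)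
    (e : E.Fiber x) : ∃ c : ℂ, e = c • u :=
  let ⟨c, hc⟩ := (finrank_eq_one_iff_of_nonzero' u hu).1 ((E.finrank_fiber x).trans hE) e
  ⟨c, hc.symm⟩

/-- A fibrewise linear map from a line bundle is holomorphic if it takes some local frame near
each point to a holomorphic section. -/
def HolHom.ofLocalFrame (hE : E.rank = 1) (f : ∀ x, E.Fiber x →L[ℂ] F.Fiber x)
    (h : ∀ x₀, ∃ l : ∀ x, E.Fiber x, HolAt E l x₀ ∧ (∀ᶠ x in 𝓝 x₀, l x ≠ 0) ∧
      HolAt F (fun x => f x (l x)) x₀) : HolHom E F where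
  toFun := f
  holomorphic := by
    intro p
    obtain ⟨l, hl, hl0, hfl⟩ := h p.proj
    have hp := Bundle.contMDiffAt_proj (n := ω) (IB := 𝓘(ℂ)) E.Fiber (p := p)
    -- The coefficient of `p'` with respect to the frame `l`, as a function on the total space; the
    -- map is this coefficient times the section `f l`.
    have hc : ContMDiffAt (𝓘(ℂ).prod 𝓘(ℂ, E.Model)) 𝓘(ℂ) ω (fun p' : E.Total =>
        lineCoord hE p.proj p' / lineCoord hE p.proj ⟨p'.proj, l p'.proj⟩) p := by
      refine ContMDiffAt.div₀ ?_ ((hl.lineCoord hE).comp p hp) (lineCoord_ne_zero hE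
        (FiberBundle.mem_baseSet_trivializationAt' _) hl0.self_of_nhds)
      exact (modelCoord hE).toContinuousLinearMap.contMDiff.contMDiffAt.comp p
        ((Bundle.contMDiffAt_totalSpace (f := fun p' : E.Total => p')).1 contMDiffAt_id).2
    refine Bundle.contMDiffAt_totalSpace.2 ⟨hp, ?_⟩
    refine (hc.smul ((holAt_iff.1 hfl).comp p hp)).congr_of_eventuallyEq ?_
    have hpt : Tendsto (Bundle.TotalSpace.proj : E.Total → X) (𝓝 p) (𝓝 p.proj) := hp.continuousAt
    filter_upwards [hpt.eventually (eventually_mem_baseSet E p.proj),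
      hpt.eventually (eventually_mem_baseSet F p.proj), hpt.eventually hl0] with p' hx hx' h0
    obtain ⟨x, e⟩ := p'
    dsimp only at hx hx' h0
    obtain ⟨c, rfl⟩ := HolBundle.exists_eq_smul hE h0 e
    change _ = (lineCoord hE p.proj ⟨x, c • l x⟩ / lineCoord hE p.proj ⟨x, l x⟩) •
      (trivializationAt F.Model F.Fiber p.proj ⟨x, f x (l x)⟩).2
    rw [lineCoord_smul hE hx, mul_div_cancel_right₀ _ (lineCoord_ne_zero hE hx h0)]
    dsimp only
    rw [map_smul]
    exact ((trivializationAt F.Model F.Fiber p.proj).linear ℂ hx').map_smul _ _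

/-- The linear map between one-dimensional fibres taking the basis `u` to `w`. -/
def lineMap (hE : E.rank = 1) {x : X} (u : E.Fiber x) (w : F.Fiber x) :
    E.Fiber x →L[ℂ] F.Fiber x :=
  -- Any coordinate serves, being normalized to be `1` at `u`; for `u = 0` the result is the zero
  -- map.
  let θ := (Module.basisUnique Unit ((E.finrank_fiber x).trans hE)).coord ()
  LinearMap.toContinuousLinearMap (((θ u)⁻¹ • θ).smulRight w)

lemma lineMap_apply_self (hE : E.rank = 1) {x : X} {u : E.Fiber x} (hu : u ≠ 0) (w : F.Fiber x) :
    lineMap hE u w u = w := by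
  have h : (Module.basisUnique Unit ((E.finrank_fiber x).trans hE)).coord () u ≠ 0 := by
    rw [Module.Basis.coord_apply]
    exact fun h => hu (Module.basisUnique_repr_eq_zero_iff.1 h)
  simp [lineMap, -Module.Basis.coord_apply, inv_mul_cancel₀ h]

/-- The homomorphism of a line bundle `E` to `F` which takes the basis `u x` of each fibre to
`w x`, given that `u` and `w` are locally the same multiples of holomorphic sections. -/
def HolHom.ofFiberBasis (hE : E.rank = 1) (u : ∀ x, E.Fiber x) (w : ∀ x, F.Fiber x)
    (hu : ∀ x, u x ≠ 0)
    (h : ∀ x₀, ∃ c : X → ℂ, (∀ᶠ x in 𝓝 x₀, c x ≠ 0) ∧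
      HolAt E (fun x => c x • u x) x₀ ∧ HolAt F (fun x => c x • w x) x₀) : HolHom E F :=
  HolHom.ofLocalFrame hE (fun x => lineMap hE (u x) (w x)) fun x₀ => by
    obtain ⟨c, hc, h1, h2⟩ := h x₀
    refine ⟨_, h1, hc.mono fun x hx => smul_ne_zero hx (hu x), ?_⟩
    simpa only [map_smul, lineMap_apply_self hE (hu _)] using h2

/-- The isomorphism of line bundles `E` and `F` which takes the basis `u x` of each fibre to
`w x`, given that `u` and `w` are locally the same multiples of holomorphic sections. -/
def HolIso.ofFiberBasis (hE : E.rank = 1) (hF : F.rank = 1) (u : ∀ x, E.Fiber x)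
    (w : ∀ x, F.Fiber x) (hu : ∀ x, u x ≠ 0) (hw : ∀ x, w x ≠ 0)
    (h : ∀ x₀, ∃ c : X → ℂ, (∀ᶠ x in 𝓝 x₀, c x ≠ 0) ∧
      HolAt E (fun x => c x • u x) x₀ ∧ HolAt F (fun x => c x • w x) x₀) : HolIso E F where
  toHolHom := HolHom.ofFiberBasis hE u w hu h
  inv := HolHom.ofFiberBasis hF w u hw fun x₀ =>
    let ⟨c, hc, h1, h2⟩ := h x₀
    ⟨c, hc, h2, h1⟩
  left_inv x e := by
    obtain ⟨c, rfl⟩ := HolBundle.exists_eq_smul hE (hu x) e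
    simp [HolHom.ofFiberBasis, HolHom.ofLocalFrame, lineMap_apply_self, hu, hw]
  right_inv x f := by
    obtain ⟨c, rfl⟩ := HolBundle.exists_eq_smul hF (hw x) f
    simp [HolHom.ofFiberBasis, HolHom.ofLocalFrame, lineMap_apply_self, hu, hw]

lemma HolIso.ofFiberBasis_apply (hE : E.rank = 1) (hF : F.rank = 1) {u : ∀ x, E.Fiber x}
    {w : ∀ x, F.Fiber x} (hu : ∀ x, u x ≠ 0) (hw : ∀ x, w x ≠ 0)
    (h : ∀ x₀, ∃ c : X → ℂ, (∀ᶠ x in 𝓝 x₀, c x ≠ 0) ∧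
      HolAt E (fun x => c x • u x) x₀ ∧ HolAt F (fun x => c x • w x) x₀) (x : X) :
    (HolIso.ofFiberBasis hE hF u w hu hw h).toFun x (u x) = w x :=
  lineMap_apply_self hE (hu x) _

/-- The composition of homomorphisms. -/
def HolHom.comp {G : HolBundle.{u, v'} X} (g : HolHom F G) (f : HolHom E F) : HolHom E G where
  toFun x := (g.toFun x).comp (f.toFun x)
  holomorphic := ContMDiff.comp g.holomorphic f.holomorphic

/-- The inverse isomorphism. -/
def HolIso.symm (f : HolIso E F) : HolIso F E where
  toHolHom := f.inv
  inv := f.toHolHom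
  left_inv := f.right_inv
  right_inv := f.left_inv

/-- The composition of isomorphisms. -/
def HolIso.trans {G : HolBundle.{u, v'} X} (f : HolIso E F) (g : HolIso F G) : HolIso E G where
  toHolHom := g.toHolHom.comp f.toHolHom
  inv := f.inv.comp g.inv
  left_inv x e := by simp [HolHom.comp, f.left_inv, g.left_inv]
  right_inv x e := by simp [HolHom.comp, f.right_inv, g.right_inv]

/-- The multiple of a homomorphism by a constant. -/
def HolHom.constSMul (a : ℂ) (f : HolHom E F) : HolHom E F where
  toFun x := a • f.toFun x
  holomorphic p := by
    have h := Bundle.contMDiffAt_totalSpace.1 (f.holomorphic p)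
    refine Bundle.contMDiffAt_totalSpace.2 ⟨h.1, ?_⟩
    have ha : ContMDiffAt (𝓘(ℂ).prod 𝓘(ℂ, E.Model)) 𝓘(ℂ) ω (fun _ : E.Total => a) p :=
      contMDiffAt_const
    refine (ha.smul h.2).congr_of_eventuallyEq ?_
    have hp := Bundle.contMDiffAt_proj (n := ω) (IB := 𝓘(ℂ)) E.Fiber (p := p)
    filter_upwards [hp.continuousAt.eventually (eventually_mem_baseSet F p.proj)] with p' hx
    exact ((trivializationAt F.Model F.Fiber p.proj).linear ℂ hx).map_smul _ _

end Sections

/-! ### Tensor products of line bundles and reindexed direct sums -/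

section Tensors

variable {X : Type u} [TopologicalSpace X] [ChartedSpace ℂ X]
  {E : HolBundle.{u, v} X} {F : HolBundle.{u, w} X} {x : X}

lemma tmul_smul_smul (a b : ℂ) (e : E.Fiber x) (f : F.Fiber x) :
    tmul (a • e) (b • f) = (a * b) • tmul e f := by
  ext φ
  change (show ℂ from φ (a • e)) • b • f = (a * b) • (show ℂ from φ e) • f
  rw [map_smul, smul_smul, smul_smul]
  congr 1
  change a * (show ℂ from φ e) * b = _
  ring

lemma smul_tmul (a : ℂ) (e : E.Fiber x) (f : F.Fiber x) : tmul (a • e) f = a • tmul e f := by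
  simpa using tmul_smul_smul a 1 e f

lemma tmul_smul (a : ℂ) (e : E.Fiber x) (f : F.Fiber x) : tmul e (a • f) = a • tmul e f := by
  simpa using tmul_smul_smul 1 a e f

/-- Evaluating `e ⊗ f` on the functional that is `1` at `e` returns `f`. -/
lemma tmul_ne_zero (hE : E.rank = 1) {e : E.Fiber x} {f : F.Fiber x} (he : e ≠ 0) (hf : f ≠ 0) :
    tmul e f ≠ 0 := by
  intro h
  have h1 : (tmul e f : (E.tensor F).Fiber x) (lineMap (F := trivialLine X) hE e (1 : ℂ)) = f := by
    change (show ℂ from lineMap (F := trivialLine X) hE e (1 : ℂ) e) • f = f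
    rw [lineMap_apply_self hE he]
    exact one_smul ℂ f
  rw [h] at h1
  exact hf h1.symm

variable (X) in
/-- The constant section `1` of `𝒪`. -/
def trivialOne (x : X) : (trivialLine X).Fiber x := (1 : ℂ)

variable (X) in
lemma rank_trivialLine : (trivialLine X).rank = 1 := Module.finrank_self ℂ

lemma trivialOne_ne_zero (x : X) : trivialOne X x ≠ 0 := one_ne_zero (α := ℂ)

lemma holAt_trivialOne (x₀ : X) : HolAt (trivialLine X) (trivialOne X) x₀ :=
  holAt_trivialLine_iff.2 contMDiffAt_const

/-- A direct sum decomposition may be reindexed and composed with isomorphisms of the summands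
and a non-zero scalar. -/
def DirectSumDecomposition.reindex {V : HolBundle.{u, v} X} {N M : ℕ}
    {F : Fin N → HolBundle.{u, v} X} (D : DirectSumDecomposition V F) (h : M = N)
    {F' : Fin M → HolBundle.{u, v} X} (e : ∀ i, HolIso (F' i) (F (Fin.cast h i)))
    {a : ℂ} (ha : a ≠ 0) : DirectSumDecomposition V F' where
  incl i := ((D.incl (Fin.cast h i)).comp (e i).toHolHom).constSMul a
  bijective x := by
    subst h
    have h1 : Function.Bijective fun (w : ∀ i, (F' i).Fiber x) (i : Fin M) =>
        a • (e i).toFun x (w i) := by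
      refine Function.bijective_iff_has_inverse.2
        ⟨fun w i => a⁻¹ • (e i).inv.toFun x (w i), fun w => ?_, fun w => ?_⟩
      · funext i
        simp [(e i).left_inv, smul_smul, inv_mul_cancel₀ ha]
      · funext i
        simp [(e i).right_inv, smul_smul, mul_inv_cancel₀ ha]
    convert (D.bijective x).comp h1 using 2 with w
    simp [HolHom.constSMul, HolHom.comp]

end Tensors

/-! ### Local frames of the powers of `K` -/

section Canonical

variable {X : Type u} [TopologicalSpace X] [ChartedSpace ℂ X] [IsManifold 𝓘(ℂ) ω X]

/-- The derivative `dz / dz₀` where `z` is the preferred chart at `x` and `z₀` that at `x₀`, so that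
`(dz₀)^d` is the element `dzRatio x₀ x ^ (-d)` of the fibre of `K^d` at `x`. -/
def dzRatio (x₀ x : X) : ℂ := tangentTransition X (achart ℂ x₀) (achart ℂ x) x

lemma eventually_dzRatio_ne_zero (x₀ : X) : ∀ᶠ x in 𝓝 x₀, dzRatio x₀ x ≠ 0 := by
  filter_upwards [(chartAt ℂ x₀).open_source.mem_nhds (mem_chart_source ℂ x₀)] with x hx
  exact tangentTransition_ne_zero _ _ x ⟨hx, mem_chart_source ℂ x⟩

/-- The local frame `(dz₀)^d` of `K^d`. -/
def dzPow (d : ℤ) (x₀ x : X) : (canonicalPow X d).Fiber x := dzRatio x₀ x ^ (-d)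

/-- The element `(dz)^d` of the fibre of `K^d` at `x`, where `z` is the preferred chart at `x`. -/
def dzOne (d : ℤ) (x : X) : (canonicalPow X d).Fiber x := (1 : ℂ)

lemma dzPow_eq_smul (d : ℤ) (x₀ x : X) : dzPow d x₀ x = (dzRatio x₀ x ^ (-d)) • dzOne d x :=
  (mul_one (dzRatio x₀ x ^ (-d))).symm

/-- The coordinate of an element of the fibre of `K^d` at `x` with respect to `dzOne d x`. -/
def dzCoord {d : ℤ} {x : X} (s : (canonicalPow X d).Fiber x) : ℂ := s

lemma eq_smul_dzOne {d : ℤ} {x : X} (s : (canonicalPow X d).Fiber x) :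
    s = dzCoord s • dzOne d x :=
  (mul_one (dzCoord s)).symm

lemma dzOne_ne_zero (d : ℤ) (x : X) : dzOne d x ≠ 0 := one_ne_zero (α := ℂ)

lemma eventually_dzPow_ne_zero (d : ℤ) (x₀ : X) : ∀ᶠ x in 𝓝 x₀, dzPow d x₀ x ≠ 0 :=
  (eventually_dzRatio_ne_zero x₀).mono fun _ h => zpow_ne_zero _ h

/-- In the trivialization at `x₀` the coordinate of `(dz₀)^d` is constantly `1`: the two transition
functions cancel by the cocycle identity. -/
lemma holAt_dzPow (d : ℤ) (x₀ : X) : HolAt (canonicalPow X d) (dzPow d x₀) x₀ := by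
  rw [holAt_iff]
  refine (contMDiffAt_const (c := (1 : ℂ))).congr_of_eventuallyEq ?_
  filter_upwards [(chartAt ℂ x₀).open_source.mem_nhds (mem_chart_source ℂ x₀)] with x hx
  change tangentTransition X (achart ℂ x) (achart ℂ x₀) x ^ (-d) *
    tangentTransition X (achart ℂ x₀) (achart ℂ x) x ^ (-d) = 1
  rw [← mul_zpow, tangentTransition_comp _ _ _ x ⟨⟨hx, mem_chart_source ℂ x⟩, hx⟩,
    tangentTransition_self _ x hx, one_zpow]

lemma rank_canonicalPow (d : ℤ) : (canonicalPow X d).rank = 1 := Module.finrank_self ℂ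

lemma rank_tensor_canonicalPow {E : HolBundle.{u, v} X} (hE : E.rank = 1) (d : ℤ) :
    (E.tensor (canonicalPow X d)).rank = 1 := by
  rw [HolBundle.rank_tensor, hE, rank_canonicalPow]

lemma exists_eq_tmul_dzOne {E : HolBundle.{u, v} X} (hE : E.rank = 1) {d : ℤ} {x : X}
    (T : (E.tensor (canonicalPow X d)).Fiber x) : ∃ e, T = tmul e (dzOne d x) := by
  have : Nontrivial (E.Fiber x) :=
    Module.nontrivial_of_finrank_pos (R := ℂ) (by rw [E.finrank_fiber, hE]; exact one_pos)
  obtain ⟨e, he⟩ := exists_ne (0 : E.Fiber x)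
  obtain ⟨c, hc⟩ := HolBundle.exists_eq_smul (rank_tensor_canonicalPow hE d)
    (tmul_ne_zero hE he (dzOne_ne_zero d x)) T
  exact ⟨c • e, by rw [hc, smul_tmul]⟩

lemma tmul_dzOne_injective {E : HolBundle.{u, v} X} (hE : E.rank = 1) {d : ℤ} {x : X}
    {e f : E.Fiber x} (h : tmul e (dzOne d x) = tmul f (dzOne d x)) : e = f := by
  by_contra hne
  refine tmul_ne_zero hE (sub_ne_zero.2 hne) (dzOne_ne_zero d x) ?_
  ext φ
  have h1 := congrArg (fun T : (E.tensor (canonicalPow X d)).Fiber x => T φ) h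
  change (show ℂ from φ e) • dzOne d x = (show ℂ from φ f) • dzOne d x at h1
  change (show ℂ from φ (e - f)) • dzOne d x = 0
  rw [map_sub]
  exact (sub_smul (show ℂ from φ e) (show ℂ from φ f) (dzOne d x)).trans (sub_eq_zero.2 h1)

/-- A section `s` of a line bundle is holomorphic if `s ⊗ (dz₀)^d` is. -/
lemma HolAt.of_tmul_dzPow {E : HolBundle.{u, v} X} (hE : E.rank = 1) {d : ℤ} {x₀ : X}
    {s : ∀ x, E.Fiber x}
    (h : HolAt (E.tensor (canonicalPow X d)) (fun x => GLHiggs.tmul (s x) (dzPow d x₀ x)) x₀) :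
    HolAt E s x₀ := by
  obtain ⟨l, hl, hl0⟩ := exists_local_frame hE x₀
  -- Tensoring with a non-zero vector is injective, so the holomorphic coefficient of `s ⊗ (dz₀)^d`
  -- over `l ⊗ (dz₀)^d` is also that of `s` over `l`.
  obtain ⟨c, hc, hs⟩ := exists_eventually_eq_smul (rank_tensor_canonicalPow hE d)
    (hl.tmul (holAt_dzPow d x₀))
    (by filter_upwards [hl0, eventually_dzPow_ne_zero d x₀] with x h1 h2
        exact tmul_ne_zero hE h1 h2) h
  refine (HolAt.smul hc hl).congr ?_
  filter_upwards [hs, eventually_dzRatio_ne_zero x₀] with x hx h0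
  apply tmul_dzOne_injective hE (d := d)
  rw [dzPow_eq_smul, tmul_smul, tmul_smul, smul_comm] at hx
  rw [smul_tmul]
  exact (smul_right_injective _ (zpow_ne_zero (-d) h0)) hx

variable (X) in
/-- The isomorphism `𝒪 = K^0`. -/
def trivialIsoCanonicalPowZero : HolIso (trivialLine X) (canonicalPow X 0) :=
  HolIso.ofFiberBasis (rank_trivialLine X) (rank_canonicalPow 0) (trivialOne X) (dzOne 0)
    trivialOne_ne_zero (dzOne_ne_zero 0) fun x₀ =>
    ⟨fun _ => 1, Eventually.of_forall fun _ => one_ne_zero,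
      (holAt_trivialOne x₀).congr (Eventually.of_forall fun x => one_smul _ _),
      (holAt_dzPow 0 x₀).congr (Eventually.of_forall fun x => by simp [dzPow_eq_smul])⟩

lemma trivialIsoCanonicalPowZero_apply {x : X} (s : (trivialLine X).Fiber x) :
    (trivialIsoCanonicalPowZero X).toFun x s = kunit s := by
  obtain ⟨c, rfl⟩ := HolBundle.exists_eq_smul (rank_trivialLine X) (trivialOne_ne_zero x) s
  rw [map_smul, trivialIsoCanonicalPowZero, HolIso.ofFiberBasis_apply]
  rfl

end Canonical

/-! ### Bases generated by `Φ`, and the isomorphisms they define -/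

section Chains

variable {X : Type u} [TopologicalSpace X] [ChartedSpace ℂ X] [IsManifold 𝓘(ℂ) ω X] {n : ℕ}
  {H : HiggsBundle.{u, v} X n} {D : HodgeStructure H}

/-- A choice of bases of the fibres of the line bundles `F_k` such that `Φ_k` takes the chosen basis
to the chosen basis times `dz`, where `z` is the preferred chart at the point. -/
structure HodgeStructure.ChainBasis (D : HodgeStructure H) where
  vec : ∀ i x, (D.F i).Fiber x
  ne_zero : ∀ i x, vec i x ≠ 0
  map_φ : ∀ i x, (D.φ i).toFun x (vec i.castSucc x) = tmul (vec i.succ x) (dzOne 1 x)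

/-- A choice made independently at each point, by recursion along the chain; injectivity of the
`Φ_k` keeps the vectors non-zero. -/
lemma HodgeStructure.IsChain.nonempty_chainBasis (hD : D.IsChain) : Nonempty D.ChainBasis := by
  have key : ∀ x, ∃ v : ∀ i, (D.F i).Fiber x, (∀ i, v i ≠ 0) ∧
      ∀ i, (D.φ i).toFun x (v i.castSucc) = tmul (v i.succ) (dzOne 1 x) := by
    intro x
    obtain ⟨l, -, hl⟩ := exists_local_frame (hD.rank_one 0) x
    choose step hstep using fun (i : Fin D.r) (e : (D.F i.castSucc).Fiber x) =>
      exists_eq_tmul_dzOne (hD.rank_one i.succ) ((D.φ i).toFun x e)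
    let v : ∀ i, (D.F i).Fiber x := fun i => Fin.induction (l x) step i
    have hv : ∀ i : Fin D.r, v i.succ = step i (v i.castSucc) := fun i => rfl
    refine ⟨v, fun i => ?_, fun i => hstep i _⟩
    induction i using Fin.induction with
    | zero => exact hl.self_of_nhds
    | succ i ih =>
      intro h0
      apply ih
      obtain ⟨g, hg, -⟩ := hD.isIso i
      rw [← hg x (v i.castSucc), hstep, ← hv, h0, ← zero_smul ℂ (0 : (D.F i.succ).Fiber x),
        smul_tmul, zero_smul, HolHom.toFun_zero]
  choose v hv using key
  exact ⟨⟨fun i x => v x i, fun i x => (hv x).1 i, fun i x => (hv x).2 i⟩⟩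

namespace HodgeStructure.ChainBasis

variable (B : D.ChainBasis)

/-- Near each point the chosen bases are, up to a common factor and powers of the derivative
`dz / dz₀`, holomorphic frames. -/
lemma exists_factor (hD : D.IsChain) (x₀ : X) :
    ∃ c : X → ℂ, (∀ᶠ x in 𝓝 x₀, c x ≠ 0) ∧
      ∀ i, HolAt (D.F i) (fun x => (c x * dzRatio x₀ x ^ (i : ℕ)) • B.vec i x) x₀ := by
  obtain ⟨l, hl, hl0⟩ := exists_local_frame (hD.rank_one 0) x₀
  -- `c` compares a holomorphic frame with the arbitrary basis of the first summand, so it need not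
  -- be continuous itself.
  choose c hc using fun x => HolBundle.exists_eq_smul (hD.rank_one 0) (B.ne_zero 0 x) (l x)
  refine ⟨c, hl0.mono fun x hx h0 => hx (by rw [hc, h0, zero_smul]), fun i => ?_⟩
  induction i using Fin.induction with
  | zero => exact hl.congr (Eventually.of_forall fun x => by simp [hc x])
  | succ i ih =>
    -- Since `dz = R dz₀`, the image of `c R^i v_i` is `c R^{i+1} v_{i+1} ⊗ dz₀`, and the factor
    -- `dz₀` may be dropped.
    refine HolAt.of_tmul_dzPow (hD.rank_one _) (d := 1) (((D.φ i).holAt ih).congr ?_)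
    filter_upwards [eventually_dzRatio_ne_zero x₀] with x h0
    rw [HolHom.toFun_smul, B.map_φ, dzPow_eq_smul, tmul_smul_smul]
    congr 1
    simp only [Fin.val_succ, Fin.val_castSucc, pow_succ, zpow_neg, zpow_one]
    field_simp

/-- The chosen basis of `F_k`, in `V`. -/
def inV (i : Fin (D.r + 1)) (x : X) : H.V.Fiber x := (D.decomp.incl i).toFun x (B.vec i x)

lemma map_Φ {i j : Fin (D.r + 1)} (hij : (j : ℕ) = i + 1) (x : X) :
    H.Φ.toFun x (B.inV i x) = tmul (B.inV j x) (dzOne 1 x) := by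
  obtain ⟨k, rfl⟩ : ∃ k : Fin D.r, k.castSucc = i := ⟨⟨i, by omega⟩, rfl⟩
  obtain rfl : j = k.succ := Fin.ext hij
  rw [inV, D.Φ_incl, B.map_φ]
  rfl

/-- The value of `Q` on the chosen bases of `F_{-m}` and `F_m`. -/
def pairing (x : X) : ℂ := H.q.toFun x (B.inV 0 x) (B.inV (Fin.last D.r) x)

/-- Symmetry of `Φ` trades a step up in one argument of `Q` for a step up in the other, which moves
every antidiagonal entry to the corner `(0, r)`. -/
lemma q_eq_pairing {i j : Fin (D.r + 1)} (hij : (i : ℕ) + j = D.r) (x : X) :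
    H.q.toFun x (B.inV i x) (B.inV j x) = B.pairing x := by
  obtain ⟨k, hk⟩ := i
  induction k generalizing j with
  | zero =>
    obtain rfl : j = Fin.last D.r := Fin.ext (by simpa using hij)
    rfl
  | succ k ih =>
    dsimp only at hij
    rw [← ih (by omega) (j := ⟨j + 1, by omega⟩) (by dsimp only; omega)]
    -- After `map_Φ` this reads `Q(v_j, v_{k+1}) dz = Q(v_k, v_{j+1}) dz`.
    have h := H.Φ_symm x (B.inV ⟨k, by omega⟩ x) (B.inV j x)
    rw [B.map_Φ (j := ⟨k + 1, hk⟩) rfl, B.map_Φ (i := j) (j := ⟨j + 1, by omega⟩) rfl] at h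
    have h2 : H.q.toFun x (B.inV j x) (B.inV ⟨k + 1, hk⟩ x) =
        H.q.toFun x (B.inV ⟨k, by omega⟩ x) (B.inV ⟨j + 1, by omega⟩ x) := by
      exact smul_left_injective ℂ (dzOne_ne_zero 1 x) h
    rw [← h2, H.q_symm]

/-- Only the last summand, a line, can pair non-trivially with the first; if it did not, `v_0` would
lie in the kernel of `Q`. -/
lemma pairing_ne_zero (hD : D.IsChain) (x : X) : B.pairing x ≠ 0 := by
  intro h0
  have h1 : B.inV 0 x = 0 := by
    refine H.q_nondegenerate x _ fun w => ?_
    obtain ⟨e, rfl⟩ := (D.decomp.bijective x).2 w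
    rw [map_sum]
    refine Finset.sum_eq_zero fun j _ => ?_
    by_cases hj : (j : ℕ) = D.r
    · obtain rfl : j = Fin.last D.r := Fin.ext hj
      obtain ⟨c, hc⟩ := HolBundle.exists_eq_smul (hD.rank_one _) (B.ne_zero (Fin.last D.r) x)
        (e (Fin.last D.r))
      rw [hc, map_smul, map_smul]
      change c • B.pairing x = 0
      rw [h0, smul_zero]
    · exact D.orthogonal 0 j (by simpa using hj) x _ _
  have h2 := (D.decomp.bijective x).1 (a₁ := Pi.single 0 (B.vec 0 x)) (a₂ := 0) (by
    dsimp only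
    rw [Finset.sum_eq_single 0]
    · simpa [inV] using h1
    · intro i _ hi
      rw [Pi.single_eq_of_ne hi, map_zero]
    · simp)
  exact B.ne_zero 0 x (by simpa using congrFun h2 0)

/-- Near each point the pairing is a holomorphic function up to the square of the factor in
`exists_factor` and a power of `dz / dz₀`. -/
lemma contMDiffAt_pairing {x₀ : X} {c : X → ℂ}
    (hc : ∀ i, HolAt (D.F i) (fun x => (c x * dzRatio x₀ x ^ (i : ℕ)) • B.vec i x) x₀) :
    ContMDiffAt 𝓘(ℂ) 𝓘(ℂ) ω (fun x => c x ^ 2 * dzRatio x₀ x ^ D.r * B.pairing x) x₀ := by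
  have h := HolAt.apply (F := trivialLine X) (H.q.holAt ((D.decomp.incl 0).holAt (hc 0)))
    ((D.decomp.incl (Fin.last D.r)).holAt (hc (Fin.last D.r)))
  refine (holAt_trivialLine_iff.1 h).congr_of_eventuallyEq (Eventually.of_forall fun x => ?_)
  have h2 : H.q.toFun x (B.inV 0 x) (B.inV (Fin.last D.r) x) = B.pairing x := rfl
  simp only [map_smul, smul_apply]
  change _ = _ • _ • B.pairing x
  simp
  ring

/-- The isomorphism `F_a ⊗ K^d ≅ F_i` for `d = a - i`. -/
def isoSummand (hD : D.IsChain) (a i : Fin (D.r + 1)) (d : ℤ) (hd : d = (a : ℕ) - (i : ℕ)) :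
    HolIso ((D.F a).tensor (canonicalPow X d)) (D.F i) :=
  HolIso.ofFiberBasis (rank_tensor_canonicalPow (hD.rank_one a) d) (hD.rank_one i)
    (fun x => tmul (B.vec a x) (dzOne d x)) (B.vec i)
    (fun x => tmul_ne_zero (hD.rank_one a) (B.ne_zero a x) (dzOne_ne_zero d x)) (B.ne_zero i)
    fun x₀ => by
      obtain ⟨c, hc, h⟩ := B.exists_factor hD x₀
      refine ⟨_, ?_, ?_, h i⟩
      · filter_upwards [hc, eventually_dzRatio_ne_zero x₀] with x h1 h2
        exact mul_ne_zero h1 (pow_ne_zero _ h2)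
      -- `(dz₀)^d = R^{-d} (dz)^d`, and `R^a R^{-d} = R^i` because `d = a - i`.
      · refine ((h a).tmul (holAt_dzPow d x₀)).congr ?_
        filter_upwards [eventually_dzRatio_ne_zero x₀] with x h2
        rw [dzPow_eq_smul, tmul_smul_smul]
        congr 1
        rw [mul_assoc, ← zpow_natCast, ← zpow_natCast, ← zpow_add₀ h2, hd]
        congr 2
        ring

lemma isoSummand_tmul (hD : D.IsChain) (a i : Fin (D.r + 1)) (d : ℤ)
    (hd : d = (a : ℕ) - (i : ℕ)) (x : X) (b : ℂ) (s : (canonicalPow X d).Fiber x) :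
    (B.isoSummand hD a i d hd).toFun x (tmul (b • B.vec a x) s) =
      (b * dzCoord s) • B.vec i x := by
  conv_lhs => rw [eq_smul_dzOne s]
  rw [tmul_smul_smul, HolHom.toFun_smul, isoSummand, HolIso.ofFiberBasis_apply]

/-- The isomorphism `F_a ⊗ F_a ≅ K^c` for `c = r - 2a` induced by `Q` and `Φ`. -/
def isoSquare (hD : D.IsChain) (a : Fin (D.r + 1)) (c : ℤ) (hc : c = (D.r : ℤ) - 2 * (a : ℕ)) :
    HolIso ((D.F a).tensor (D.F a)) (canonicalPow X c) :=
  HolIso.ofFiberBasis (by rw [HolBundle.rank_tensor, hD.rank_one]) (rank_canonicalPow c)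
    (fun x => tmul (B.vec a x) (B.vec a x)) (fun x => B.pairing x • dzOne c x)
    (fun x => tmul_ne_zero (hD.rank_one a) (B.ne_zero a x) (B.ne_zero a x))
    (fun x => smul_ne_zero (B.pairing_ne_zero hD x) (dzOne_ne_zero c x))
    fun x₀ => by
      obtain ⟨μ, hμ, h⟩ := B.exists_factor hD x₀
      -- The factor `μ² R^{2a}` also suits the target: `μ² R^r pairing` is holomorphic and `(dz₀)^c`
      -- contributes `R^{-c}`, with `r - c = 2a`.
      refine ⟨fun x => (μ x * dzRatio x₀ x ^ (a : ℕ)) * (μ x * dzRatio x₀ x ^ (a : ℕ)), ?_, ?_, ?_⟩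
      · filter_upwards [hμ, eventually_dzRatio_ne_zero x₀] with x h1 h2
        exact mul_self_ne_zero.2 (mul_ne_zero h1 (pow_ne_zero _ h2))
      · refine ((h a).tmul (h a)).congr (Eventually.of_forall fun x => ?_)
        rw [tmul_smul_smul]
      · refine (HolAt.smul (B.contMDiffAt_pairing h) (holAt_dzPow c x₀)).congr ?_
        filter_upwards [eventually_dzRatio_ne_zero x₀] with x h2
        rw [dzPow_eq_smul, smul_smul, smul_smul]
        congr 1
        have h3 : dzRatio x₀ x ^ D.r * dzRatio x₀ x ^ (-c) =
            dzRatio x₀ x ^ (a : ℕ) * dzRatio x₀ x ^ (a : ℕ) := by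
          rw [← zpow_natCast, ← zpow_natCast, ← zpow_add₀ h2, ← zpow_add₀ h2, hc]
          congr 1
          ring
        linear_combination -(μ x ^ 2 * B.pairing x) * h3

/-- Any isomorphism `F_a ⊗ F_a ≅ K^c`, `c = r - 2a`, is up to a constant the one induced by `Q` and
`Φ`. -/
lemma exists_eq_sq_smul_pairing [CompactSpace X] [ConnectedSpace X] (hD : D.IsChain)
    (a : Fin (D.r + 1)) (c : ℤ) (hc : c = (D.r : ℤ) - 2 * (a : ℕ))
    (β : HolIso ((D.F a).tensor (D.F a)) (canonicalPow X c)) :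
    ∃ b : ℂ, b ≠ 0 ∧ ∀ x, β.toFun x (tmul (B.vec a x) (B.vec a x)) =
      (b ^ 2 * B.pairing x) • dzOne c x := by
  have hu : ∀ x, tmul (B.vec a x) (B.vec a x) ≠ 0 := fun x =>
    tmul_ne_zero (hD.rank_one a) (B.ne_zero a x) (B.ne_zero a x)
  -- `g` is the ratio of `β` to `isoSquare`; it does not depend on the vector used, so it can be
  -- computed with a holomorphic frame.
  choose g hg using fun x => HolBundle.exists_eq_smul (rank_canonicalPow c)
    (smul_ne_zero (B.pairing_ne_zero hD x) (dzOne_ne_zero c x))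
    (β.toFun x (tmul (B.vec a x) (B.vec a x)))
  have hg0 : ∀ x, g x ≠ 0 := by
    intro x h0
    apply hu x
    rw [← β.left_inv x (tmul (B.vec a x) (B.vec a x)), hg x, h0, zero_smul, HolHom.toFun_zero]
  have hgs : ContMDiff 𝓘(ℂ) 𝓘(ℂ) ω g := by
    intro x₀
    let ι := B.isoSquare hD a c hc
    have hι : ∀ x, ι.toFun x (tmul (B.vec a x) (B.vec a x)) = B.pairing x • dzOne c x :=
      fun x => HolIso.ofFiberBasis_apply ..
    obtain ⟨μ, hμ, h⟩ := B.exists_factor hD x₀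
    have hs := (h a).tmul (h a)
    obtain ⟨k, hk, hk'⟩ := exists_eventually_eq_smul (rank_canonicalPow c) (ι.toHolHom.holAt hs)
      (by
        filter_upwards [hμ, eventually_dzRatio_ne_zero x₀] with x h1 h2
        rw [tmul_smul_smul, HolHom.toFun_smul, hι]
        exact smul_ne_zero (mul_self_ne_zero.2 (mul_ne_zero h1 (pow_ne_zero _ h2)))
          (smul_ne_zero (B.pairing_ne_zero hD x) (dzOne_ne_zero c x)))
      (β.toHolHom.holAt hs)
    refine hk.congr_of_eventuallyEq ?_
    filter_upwards [hk', hμ, eventually_dzRatio_ne_zero x₀] with x hx h1 h2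
    rw [tmul_smul_smul, HolHom.toFun_smul, HolHom.toFun_smul, hι, hg, smul_comm (k x)] at hx
    exact smul_left_injective ℂ (smul_ne_zero (B.pairing_ne_zero hD x) (dzOne_ne_zero c x))
      (smul_right_injective _ (mul_self_ne_zero.2 (mul_ne_zero h1 (pow_ne_zero _ h2))) hx)
  have : IsManifold 𝓘(ℂ) 1 X := IsManifold.of_le (n := ω) le_top
  obtain ⟨g₀, rfl⟩ := (hgs.mdifferentiable (by simp)).exists_eq_const_of_compactSpace
  -- A square root, because scaling the vectors by `b` scales `Q` by `b²`.
  obtain ⟨b, hb⟩ := IsAlgClosed.exists_pow_nat_eq g₀ two_pos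
  obtain ⟨x⟩ : Nonempty X := inferInstance
  refine ⟨b, ?_, fun x => ?_⟩
  · rintro rfl
    exact hg0 x (by simpa using hb.symm)
  · rw [hg, hb, smul_smul]
    rfl

end HodgeStructure.ChainBasis

end Chains

/-! ### The rank, and the standard form -/

section StandardForm

variable {X : Type u} [TopologicalSpace X] [ChartedSpace ℂ X] [IsManifold 𝓘(ℂ) ω X] {n : ℕ}

/-- The identity of a holomorphic vector bundle. -/
def HolHom.id (E : HolBundle.{u, v} X) : HolHom E E where
  toFun x := ContinuousLinearMap.id ℂ (E.Fiber x)
  holomorphic := contMDiff_id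

/-- The identity of a `GL(n, ℝ)`-Higgs bundle. -/
def HiggsIso.refl (H : HiggsBundle.{u, v} X n) : HiggsIso H H where
  toHolHom := HolHom.id H.V
  inv := HolHom.id H.V
  left_inv _ _ := rfl
  right_inv _ _ := rfl
  map_q _ _ _ := rfl
  map_Φ _ _ := rfl

variable {H : HiggsBundle.{u, v} X n} {D : HodgeStructure H}

lemma HodgeStructure.IsChain.eq_add_one [Nonempty X] (hD : D.IsChain) : n = D.r + 1 := by
  obtain ⟨x⟩ := ‹Nonempty X›
  let e : (∀ i, (D.F i).Fiber x) →ₗ[ℂ] H.V.Fiber x :=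
    ∑ i, ((D.decomp.incl i).toFun x).toLinearMap ∘ₗ LinearMap.proj i
  have he : Function.Bijective e := by
    convert D.decomp.bijective x using 1
    ext w
    simp [e]
  refine H.rank_eq.symm.trans ?_
  rw [← H.V.finrank_fiber x, ← (LinearEquiv.ofBijective e he).finrank_eq,
    Module.finrank_pi_fintype]
  simp [HolBundle.finrank_fiber, hD.rank_one]

namespace HodgeStructure.ChainBasis

variable (B : D.ChainBasis)

/-- The summands of the standard form, embedded in `V`. -/
def standardDecomp (hD : D.IsChain) (hn : n = D.r + 1) (a : Fin (D.r + 1)) {b : ℂ} (hb : b ≠ 0) :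
    DirectSumDecomposition H.V
      (fun i : Fin n => (D.F a).tensor (canonicalPow X ((a : ℕ) - (i : ℕ)))) :=
  D.decomp.reindex hn (fun i => B.isoSummand hD a (Fin.cast hn i) _ rfl) hb

lemma standardDecomp_tmul (hD : D.IsChain) (hn : n = D.r + 1) (a : Fin (D.r + 1)) {b : ℂ}
    (hb : b ≠ 0) (i : Fin n) (x : X) (z : ℂ)
    (s : (canonicalPow X ((a : ℕ) - (i : ℕ))).Fiber x) :
    ((B.standardDecomp hD hn a hb).incl i).toFun x (tmul (z • B.vec a x) s) =
      (b * (z * dzCoord s)) • B.inV (Fin.cast hn i) x := by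
  change b • (D.decomp.incl (Fin.cast hn i)).toFun x
    ((B.isoSummand hD a (Fin.cast hn i) _ rfl).toFun x (tmul (z • B.vec a x) s)) = _
  rw [B.isoSummand_tmul, HolHom.toFun_smul, smul_smul]
  rfl

/-- The new summands sit inside the old ones, so the vanishing conditions on `Q` and `Φ` are
inherited. -/
lemma exists_standardDecomp_eq (hD : D.IsChain) (hn : n = D.r + 1) (a : Fin (D.r + 1)) {b : ℂ}
    (hb : b ≠ 0) (i : Fin n) (x : X) (e : ((D.F a).tensor
      (canonicalPow X ((a : ℕ) - (i : ℕ)))).Fiber x) :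
    ∃ f, ((B.standardDecomp hD hn a hb).incl i).toFun x e =
      (D.decomp.incl (Fin.cast hn i)).toFun x f :=
  ⟨b • (B.isoSummand hD a (Fin.cast hn i) _ rfl).toFun x e, by rw [HolHom.toFun_smul]; rfl⟩

/-- The standard form of `(V, Q, Φ)` itself, for a suitably scaled decomposition. -/
def standardForm (hD : D.IsChain) (hn : n = D.r + 1) (a : Fin (D.r + 1)) (c : ℤ)
    (hc : c = (D.r : ℤ) - 2 * (a : ℕ)) (β : HolIso ((D.F a).tensor (D.F a)) (canonicalPow X c))
    {b : ℂ} (hb : b ≠ 0) (hβ : ∀ x, β.toFun x (tmul (B.vec a x) (B.vec a x)) =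
      (b ^ 2 * B.pairing x) • dzOne c x) :
    StandardForm H (D.F a) (a : ℕ) c (fun x l l' => β.toFun x (tmul l l')) where
  size := by omega
  decomp := B.standardDecomp hD hn a hb
  q_antidiag i j hij x l l' s s' := by
    obtain ⟨z, rfl⟩ := HolBundle.exists_eq_smul (hD.rank_one a) (B.ne_zero a x) l
    obtain ⟨z', rfl⟩ := HolBundle.exists_eq_smul (hD.rank_one a) (B.ne_zero a x) l'
    have h : β.toFun x (tmul (z • B.vec a x) (z' • B.vec a x)) =
        ((z * z') * (b ^ 2 * B.pairing x)) • dzOne c x := by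
      rw [tmul_smul_smul, HolHom.toFun_smul, hβ, smul_smul]
    dsimp only
    rw [h, standardDecomp_tmul, standardDecomp_tmul, HolHom.toFun_smul, smul_apply, map_smul,
      B.q_eq_pairing (by simp only [Fin.val_cast]; omega)]
    -- Each inclusion contributes one `b`, matching the `b²` in `hβ`.
    change (b * (z * dzCoord s)) * ((b * (z' * dzCoord s')) * B.pairing x) =
      ((z * z') * (b ^ 2 * B.pairing x) * 1) * (dzCoord s * dzCoord s')
    ring
  q_zero i j hij x e f := by
    obtain ⟨e', he⟩ := B.exists_standardDecomp_eq hD hn a hb i x e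
    obtain ⟨f', hf⟩ := B.exists_standardDecomp_eq hD hn a hb j x f
    rw [he, hf]
    exact D.orthogonal _ _ (by simp only [Fin.val_cast]; omega) x _ _
  Φ_subdiag i j hij x l s κ := by
    obtain ⟨z, rfl⟩ := HolBundle.exists_eq_smul (hD.rank_one a) (B.ne_zero a x) l
    rw [standardDecomp_tmul, standardDecomp_tmul, HolHom.toFun_smul,
      B.map_Φ (j := Fin.cast hn j) (by simpa using hij)]
    conv_rhs => rw [eq_smul_dzOne κ, tmul_smul_smul]
    congr 1
    change b * (z * (dzCoord s * dzCoord κ)) = _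
    ring
  Φ_last i hi x e := by
    obtain ⟨e', he⟩ := B.exists_standardDecomp_eq hD hn a hb i x e
    obtain ⟨i, hi'⟩ := i
    obtain rfl : i = D.r := by dsimp only at hi; omega
    rw [he]
    exact D.Φ_last x e'

lemma isoStandard (B : D.ChainBasis) [CompactSpace X] [ConnectedSpace X] (hD : D.IsChain)
    (hn : n = D.r + 1) (a : Fin (D.r + 1)) (c : ℤ) (hc : c = (D.r : ℤ) - 2 * (a : ℕ))
    (β : HolIso ((D.F a).tensor (D.F a)) (canonicalPow X c)) :
    D.IsoStandard (D.F a) (a : ℕ) c (fun x l l' => β.toFun x (tmul l l')) := by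
  obtain ⟨b, hb, hβ⟩ := B.exists_eq_sq_smul_pairing hD a c hc β
  -- `H` itself is in standard form for the new decomposition, so the identity serves and only the
  -- equality of summands remains.
  refine ⟨H, HiggsIso.refl H, B.standardForm hD hn a c hc β hb hβ, fun i j hij x => ?_⟩
  obtain rfl : i = Fin.cast hn j := Fin.ext hij
  let ι := B.isoSummand hD a (Fin.cast hn j) _ rfl
  refine Set.Subset.antisymm ?_ ?_
  · rintro _ ⟨e, rfl⟩
    refine ⟨b⁻¹ • ι.inv.toFun x e, ?_⟩
    change b • (D.decomp.incl (Fin.cast hn j)).toFun x (ι.toFun x (b⁻¹ • ι.inv.toFun x e)) =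
      (D.decomp.incl (Fin.cast hn j)).toFun x e
    rw [HolHom.toFun_smul, ι.right_inv, HolHom.toFun_smul, smul_smul, mul_inv_cancel₀ hb, one_smul]
  · rintro _ ⟨e, rfl⟩
    obtain ⟨f, hf⟩ := B.exists_standardDecomp_eq hD hn a hb j x e
    exact ⟨f, hf.symm⟩

end HodgeStructure.ChainBasis

end StandardForm

end GLHiggs

end

/-! ### The two parities of the rank -/

theorem mainTheorem3 {X : Type*} [TopologicalSpace X] [T2Space X] [CompactSpace X]
    [ConnectedSpace X] [ChartedSpace ℂ X] [IsManifold 𝓘(ℂ) ω X] {n : ℕ}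
    (H : GLHiggs.HiggsBundle X n) (D : GLHiggs.HodgeStructure H) (hD : D.IsChain) :
    n = D.r + 1 ∧
    (Even n → ∃ a : Fin (D.r + 1), D.weight a = -1 / 2 ∧
      Nonempty (GLHiggs.HolIso ((D.F a).tensor (D.F a)) (GLHiggs.canonical X)) ∧
      (∀ (k : ℤ) (i : Fin (D.r + 1)), D.weight i = -1 / 2 + k →
        Nonempty (GLHiggs.HolIso (D.F i) ((D.F a).tensor (GLHiggs.canonicalPow X (-k))))) ∧
      ∀ σ : GLHiggs.HolIso ((D.F a).tensor (D.F a)) (GLHiggs.canonical X),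
        D.IsoStandard (D.F a) (a : ℕ) 1 (fun x l l' => σ.toFun x (GLHiggs.tmul l l'))) ∧
    (Odd n → ∃ a : Fin (D.r + 1), D.weight a = 0 ∧
      Nonempty (GLHiggs.HolIso ((D.F a).tensor (D.F a)) (GLHiggs.trivialLine X)) ∧
      (∀ (k : ℤ) (i : Fin (D.r + 1)), D.weight i = k →
        Nonempty (GLHiggs.HolIso (D.F i) ((D.F a).tensor (GLHiggs.canonicalPow X (-k))))) ∧
      ∀ τ : GLHiggs.HolIso ((D.F a).tensor (D.F a)) (GLHiggs.trivialLine X),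
        D.IsoStandard (D.F a) (a : ℕ) 0
          (fun x l l' => GLHiggs.kunit (τ.toFun x (GLHiggs.tmul l l')))) := by
  obtain ⟨B⟩ := hD.nonempty_chainBasis
  have hn : n = D.r + 1 := hD.eq_add_one
  refine ⟨hn, ?_, ?_⟩
  · rintro ⟨m, hm⟩
    -- `n = r + 1` is positive, so `n = 2b + 2` and `r = 2b + 1`: weight `-1/2` sits at index `b`,
    -- with `c = r - 2b = 1`.
    obtain ⟨b, rfl⟩ : ∃ b, m = b + 1 := ⟨m - 1, by omega⟩
    have hr : D.r = 2 * b + 1 := by omega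
    have hrQ : (D.r : ℚ) = 2 * b + 1 := by exact_mod_cast hr
    have hc : (1 : ℤ) = (D.r : ℤ) - 2 * (b : ℕ) := by omega
    refine ⟨⟨b, by omega⟩, ?_, ⟨B.isoSquare hD _ 1 hc⟩, fun k i hk => ⟨?_⟩,
      fun σ => B.isoStandard hD hn _ 1 hc σ⟩
    · rw [GLHiggs.HodgeStructure.weight, hrQ]
      ring
    · refine (B.isoSummand hD _ i (-k) ?_).symm
      rw [GLHiggs.HodgeStructure.weight, hrQ] at hk
      have h : ((-k : ℤ) : ℚ) = (((b : ℕ) : ℤ) - ((i : ℕ) : ℤ) : ℤ) := by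
        push_cast
        linarith
      exact_mod_cast h
  · rintro ⟨b, hb⟩
    have hr : D.r = 2 * b := by omega
    have hrQ : (D.r : ℚ) = 2 * b := by exact_mod_cast hr
    have hc : (0 : ℤ) = (D.r : ℤ) - 2 * (b : ℕ) := by omega
    refine ⟨⟨b, by omega⟩, ?_,
      ⟨(B.isoSquare hD _ 0 hc).trans (GLHiggs.trivialIsoCanonicalPowZero X).symm⟩,
      fun k i hk => ⟨?_⟩, fun τ => ?_⟩
    · rw [GLHiggs.HodgeStructure.weight, hrQ]
      ring
    · refine (B.isoSummand hD _ i (-k) ?_).symm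
      rw [GLHiggs.HodgeStructure.weight, hrQ] at hk
      have h : ((-k : ℤ) : ℚ) = (((b : ℕ) : ℤ) - ((i : ℕ) : ℤ) : ℤ) := by
        push_cast
        linarith
      exact_mod_cast h
    -- `isoStandard` expects values in `K^0`, so `τ` is first composed with `𝒪 = K^0`, which is
    -- `kunit` on fibres.
    · have h := B.isoStandard hD hn ⟨b, by omega⟩ 0 hc
        (τ.trans (GLHiggs.trivialIsoCanonicalPowZero X))
      convert h using 4
      exact (GLHiggs.trivialIsoCanonicalPowZero_apply _).symm
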